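/- Let $P$ be a poset, and let $P_0$ be $P$ with a new bottom element $0$ adjoined; assume that $P_0$ is locally finite. Let $P^*$ be the set of finite words $w=w(1)\cdots w(|w|)$ over $P$ with generalized subword order: $u\le w$ if and only if there are indices $i_1<\dots<i_k$, $k=|u|$, with $u(j)\le_P w(i_j)$ for $1\le j\le k$. Suppose that $P$ is a rooted forest, i.e. each component of its Hasse diagram is a tree with a unique minimal element; then each $x\in P$ covers exactly one element of $P_0$, denoted $x^-$. An embedding of $u$ in $w$ is a sequence $\eta=\eta(1)\cdots\eta(|w|)$ over $P_0$ whose restriction to its nonzero letters is $u$ and which satisfies $\eta(j)\le w(j)$ in $P_0$ for all $j$. It is normal if 1. $\eta(j)\in\{w(j),\,w(j)^-,\,0\}$ for $1\le j\le |w|$; and 2. for every $x\in P$ and every run $[r,t]$ of $x$'s in $w$ (a maximal interval of positions with $w(r)=\dots=w(t)=x$): if $x$ is minimal in $P$, then $\eta(j)\ne 0$ for all $j$ with $r<j\le t$; if $x$ is not minimal, then $\eta(r)\neq 0$. The defect of $\eta$ is $\mathrm{def}(\eta)=\#\{i:\eta(i)=w(i)^-\}$. **Theorem.** If $P$ is a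 rooted forest with $P_0$ locally finite, then for all $u,w\in P^*$ the Möbius function $\mu$ of $P^*$ is given by $$\mu(u,w)=\sum_{\eta}(-1)^{\mathrm{def}(\eta)},$$ where the sum is over all normal embeddings $\eta$ of $u$ in $w$ (and $\mu(u,w)=0$ when $u\not\le w$). In particular this holds for composition order: the chain $P=\mathbb{P}$ of positive integers is a rooted forest, with $1^-=0$ and $k^-=k-1$ for $k\ge 2$, and the same formula gives the Möbius function of $\mathbb{P}^*$. -/

import Mathlib

/-- `P^*`: the finite words over the alphabet `P`.  (A structure of its own, so that the
lexicographic order that Mathlib puts on `List P` does not interfere.) -/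
@[ext]
structure Word (P : Type*) where
  letters : List P

namespace Word

variable {P : Type*}

/-- The length `|w|` of a word. -/
abbrev length (w : Word P) : ℕ := w.letters.length

/-- The letter of `w` at position `j` (positions are counted from `0`). -/
abbrev letter (w : Word P) (j : Fin w.length) : P := w.letters.get j

/-- Generalized subword order: `u ≤ w` if and only if `w` has a subword (`List.Sublist`) of the
same length as `u` such that each letter of `u` is at most the corresponding letter of that
subword. -/
instance instPartialOrder [PartialOrder P] : PartialOrder (Word P) where
  le u w := ∃ v : List P, v.Sublist w.letters ∧ List.Forall₂ (fun a b => a ≤ b) u.letters v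
  le_refl u := ⟨u.letters, List.Sublist.refl _, List.forall₂_refl _⟩
  le_trans u v w h₁ h₂ := by
    obtain ⟨x, hx, hux⟩ := h₁
    obtain ⟨y, hy, hvy⟩ := h₂
    have h : List.SublistForall₂ (fun a b : P => a ≤ b) u.letters w.letters :=
      Trans.trans (List.sublistForall₂_iff.2 ⟨x, hux, hx⟩) (List.sublistForall₂_iff.2 ⟨y, hvy, hy⟩)
    obtain ⟨l, hl, hlw⟩ := List.sublistForall₂_iff.1 h
    exact ⟨l, hlw, hl⟩
  le_antisymm u w h₁ h₂ := by
    obtain ⟨x, hx, hux⟩ := h₁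
    obtain ⟨y, hy, hwy⟩ := h₂
    have e₁ := hux.length_eq
    have e₂ := hwy.length_eq
    have e₃ := hx.length_le
    have e₄ := hy.length_le
    have hxw : x = w.letters := hx.eq_of_length (by omega)
    have hyu : y = u.letters := hy.eq_of_length (by omega)
    subst hxw hyu
    have key : ∀ l m : List P, List.Forall₂ (fun a b => a ≤ b) l m →
        List.Forall₂ (fun a b => a ≤ b) m l → l = m := by
      intro l m h
      induction h with
      | nil => intro _; rfl
      | cons hab _ ih =>
        intro h'
        rw [List.forall₂_cons] at h'
        rw [le_antisymm hab h'.1, ih h'.2]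
    exact Word.ext (key _ _ hux hwy)

theorem finite_Iic_of_locallyFinite [PartialOrder P] [LocallyFiniteOrder (WithBot P)] (a : P) :
    (Set.Iic a).Finite := by
  refine ((Set.finite_Icc (⊥ : WithBot P) (a : WithBot P)).preimage
    WithBot.coe_injective.injOn).subset ?_
  intro b hb
  exact ⟨bot_le, WithBot.coe_le_coe.2 hb⟩

theorem finite_below [PartialOrder P] [LocallyFiniteOrder (WithBot P)] (w : List P) :
    {u : List P | List.SublistForall₂ (fun a b : P => a ≤ b) u w}.Finite := by
  induction w with
  | nil =>
    refine (Set.finite_singleton ([] : List P)).subset ?_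
    intro u hu
    cases hu
    rfl
  | cons a w ih =>
    refine (((finite_Iic_of_locallyFinite a).image2 List.cons ih).union
      (ih.union (Set.finite_singleton ([] : List P)))).subset ?_
    intro u hu
    cases hu with
    | nil => exact Or.inr (Or.inr rfl)
    | cons h₁ h₂ => exact Or.inl ⟨_, h₁, _, h₂, rfl⟩
    | cons_right h => exact Or.inr (Or.inl h)

/-- `P^*` is locally finite as soon as `P_0` is. -/
noncomputable instance instLocallyFiniteOrder [PartialOrder P] [LocallyFiniteOrder (WithBot P)] :
    LocallyFiniteOrder (Word P) :=
  LocallyFiniteOrder.ofFiniteIcc fun u w => by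
    have hinj : Function.Injective (Word.letters (P := P)) := fun _ _ h => Word.ext h
    refine ((finite_below w.letters).preimage hinj.injOn).subset ?_
    rintro v ⟨-, l, hl, hvl⟩
    exact List.sublistForall₂_iff.2 ⟨l, hvl, hl⟩

open Classical in
/-- The (integer-valued) Möbius function `μ = μ_{P^*}` of `P^*`. -/
noncomputable def moebius [PartialOrder P] [LocallyFiniteOrder (WithBot P)] (u w : Word P) : ℤ :=
  IncidenceAlgebra.mu ℤ u w

end Word

/-- `P` is a rooted forest: each component of its Hasse diagram is a tree, and has a unique
minimal element. -/
def IsRootedForest (P : Type*) [PartialOrder P] : Prop :=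
  ∀ C : (SimpleGraph.hasse P).ConnectedComponent,
    C.toSimpleGraph.IsTree ∧ ∃! m : P, Minimal (fun x => x ∈ C) m

namespace IsRootedForest

variable {P : Type*} [PartialOrder P]

/-- In a rooted forest `P` with `P_0` locally finite, every element of `P` covers exactly one
element of `P_0`. -/
theorem existsUnique_covBy [LocallyFiniteOrder (WithBot P)] (hP : IsRootedForest P) (x : P) :
    ∃! y : WithBot P, y ⋖ (x : WithBot P) := by
  have hcov : ∀ y z : P, y < z → ∃ q : P, q ⋖ z := by
    intro y z hyz
    obtain ⟨q, hq, hqz⟩ := exists_le_covBy_of_lt (WithBot.coe_lt_coe.2 hyz)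
    induction q with
    | bot => simp at hq
    | coe q => exact ⟨q, WithBot.coe_covBy_coe.1 hqz⟩
  set C := (SimpleGraph.hasse P).connectedComponentMk x with hC
  have hxC : x ∈ C := rfl
  obtain ⟨hT, m, hm, hmu⟩ := hP C
  have hmemdown : ∀ y z : P, y ⋖ z → z ∈ C → y ∈ C := by
    intro y z hyz hz
    have hadj : (SimpleGraph.hasse P).Adj y z := Or.inl hyz
    exact (SimpleGraph.ConnectedComponent.sound hadj.reachable).trans hz
  have hbridge : ∀ y y' : P, y ⋖ x → y' ⋖ x → y = y' := by
    intro y y' hy hy'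
    by_contra hne
    have hyC := hmemdown y x hy hxC
    have hyC' := hmemdown y' x hy' hxC
    have hadj : C.toSimpleGraph.Adj ⟨x, hxC⟩ ⟨y, hyC⟩ :=
      (C.toSimpleGraph_adj hxC hyC).2 (Or.inr hy)
    have hb := SimpleGraph.isAcyclic_iff_forall_adj_isBridge.1 hT.isAcyclic hadj
    rw [SimpleGraph.isBridge_iff] at hb
    set D := C.toSimpleGraph.deleteEdges {s(⟨x, hxC⟩, ⟨y, hyC⟩)} with hD
    have hreach : ∀ n : ℕ, ∀ z : P, (Set.Iic z).ncard ≤ n → ∀ hz : z ∈ C, z < x →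
        D.Reachable ⟨m, hm.1⟩ ⟨z, hz⟩ := by
      intro n
      induction n with
      | zero =>
        intro z hn
        have hpos := (Set.ncard_pos (Word.finite_Iic_of_locallyFinite z)).2 ⟨z, le_refl z⟩
        omega
      | succ n ih =>
        intro z hn hz hzx
        by_cases hmin : Minimal (fun t => t ∈ C) z
        · have := hmu z hmin
          subst this
          exact SimpleGraph.Reachable.refl _
        · have : ∃ t, t < z := by
            by_contra hno
            push Not at hno
            exact hmin ⟨hz, fun t _ htz => by
              rcases htz.lt_or_eq with h | h
              · exact absurd h (hno t)
              · exact h.ge⟩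
          obtain ⟨t, ht⟩ := this
          obtain ⟨q, hq⟩ := hcov t z ht
          have hqC := hmemdown q z hq hz
          have hcard : (Set.Iic q).ncard < (Set.Iic z).ncard :=
            Set.ncard_lt_ncard (Set.Iic_ssubset_Iic.2 hq.lt)
              (Word.finite_Iic_of_locallyFinite z)
          refine (ih q (by omega) hqC (hq.lt.trans hzx)).trans (SimpleGraph.Adj.reachable ?_)
          rw [hD, SimpleGraph.deleteEdges_adj]
          refine ⟨(C.toSimpleGraph_adj hqC hz).2 (Or.inl hq), ?_⟩
          simp only [Set.mem_singleton_iff, Sym2.eq_iff, Subtype.mk.injEq]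
          rintro (⟨h, -⟩ | ⟨-, h⟩)
          · exact (hq.lt.trans hzx).ne h
          · exact hzx.ne h
    have hadj' : D.Adj ⟨x, hxC⟩ ⟨y', hyC'⟩ := by
      rw [hD, SimpleGraph.deleteEdges_adj]
      refine ⟨(C.toSimpleGraph_adj hxC hyC').2 (Or.inr hy'), ?_⟩
      simp only [Set.mem_singleton_iff, Sym2.eq_iff, Subtype.mk.injEq]
      rintro (⟨-, h⟩ | ⟨h, -⟩)
      · exact hne h.symm
      · exact hy.lt.ne h.symm
    exact hb (hadj'.reachable.trans
      ((hreach _ y' le_rfl hyC' hy'.lt).symm.trans (hreach _ y le_rfl hyC hy.lt)))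
  obtain ⟨p, -, hp⟩ := exists_le_covBy_of_lt (WithBot.bot_lt_coe x)
  refine ⟨p, hp, fun q hq => ?_⟩
  induction p with
  | bot =>
    induction q with
    | bot => rfl
    | coe q => exact absurd hq.lt (hp.2 (WithBot.bot_lt_coe q))
  | coe p =>
    induction q with
    | bot => exact absurd hp.lt (hq.2 (WithBot.bot_lt_coe p))
    | coe q => rw [hbridge q p (WithBot.coe_covBy_coe.1 hq) (WithBot.coe_covBy_coe.1 hp)]

end IsRootedForest

/-- `x^-`: the element of `P_0 = WithBot P` covered by `x`. -/
noncomputable def parent {P : Type*} [PartialOrder P] (x : P) : WithBot P :=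
  Classical.epsilon fun y : WithBot P => y ⋖ (x : WithBot P)

/-- In a rooted forest, `x^-` is the only element of `P_0` that `x` covers. -/
theorem IsRootedForest.covBy_iff_eq_parent {P : Type*} [PartialOrder P]
    [LocallyFiniteOrder (WithBot P)] (hP : IsRootedForest P) (x : P) (y : WithBot P) :
    y ⋖ (x : WithBot P) ↔ y = parent x := by
  have h : parent x ⋖ (x : WithBot P) := Classical.epsilon_spec (hP.existsUnique_covBy x).exists
  exact ⟨fun hy => (hP.existsUnique_covBy x).unique hy h, fun hy => hy ▸ h⟩

namespace Word

variable {P : Type*}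

open Classical in
/-- `η`, a word of length `n` over `P_0`, is an expansion of `u`: the restriction of `η` to its
nonzero letters is `u`. -/
def IsExpansion (u : Word P) {n : ℕ} (η : Fin n → WithBot P) : Prop :=
  (List.ofFn η).filter (fun x => x ≠ ⊥) = u.letters.map WithBot.some

/-- `η` is an embedding of `u` in `w`. -/
def IsEmbedding [PartialOrder P] (u w : Word P) (η : Fin w.length → WithBot P) : Prop :=
  IsExpansion u η ∧ ∀ j, η j ≤ (w.letter j : WithBot P)

/-- `[r, t]` is a run of `x`'s in `w`: a maximal interval of positions at all of which the letter
of `w` is `x`. -/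
def IsRun (w : Word P) (x : P) (r t : Fin w.length) : Prop :=
  r ≤ t ∧ (∀ j ∈ Set.Icc r t, w.letter j = x) ∧
    ∀ r' t' : Fin w.length, r' ≤ r → t ≤ t' → (∀ j ∈ Set.Icc r' t', w.letter j = x) →
      r' = r ∧ t' = t

/-- `η` is a normal embedding of `u` in `w`. -/
def IsNormalEmbedding [PartialOrder P] (u w : Word P) (η : Fin w.length → WithBot P) : Prop :=
  IsEmbedding u w η ∧
  (∀ j, η j = (w.letter j : WithBot P) ∨ η j = parent (w.letter j) ∨ η j = ⊥) ∧
  ∀ (x : P) (r t : Fin w.length), IsRun w x r t →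
    (IsMin x → ∀ j, r < j → j ≤ t → η j ≠ ⊥) ∧ (¬ IsMin x → η r ≠ ⊥)

open Classical in
/-- The finite set of all normal embeddings of `u` in `w`. -/
noncomputable def normalEmbeddings [PartialOrder P] [LocallyFiniteOrder (WithBot P)]
    (u w : Word P) : Finset (Fin w.length → WithBot P) :=
  (Fintype.piFinset fun j => Finset.Icc ⊥ (w.letter j : WithBot P)).filter (IsNormalEmbedding u w)

theorem mem_normalEmbeddings [PartialOrder P] [LocallyFiniteOrder (WithBot P)] (u w : Word P)
    (η : Fin w.length → WithBot P) : η ∈ normalEmbeddings u w ↔ IsNormalEmbedding u w η := by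
  simp only [normalEmbeddings, Finset.mem_filter, Fintype.mem_piFinset, Finset.mem_Icc]
  exact ⟨fun h => h.2, fun h => ⟨fun j => ⟨bot_le, h.1.2 j⟩, h⟩⟩

open Classical in
/-- The defect of `η`: the number of positions `i` with `η(i) = w(i)^-`. -/
noncomputable def defect [PartialOrder P] (w : Word P) (η : Fin w.length → WithBot P) : ℕ :=
  (Finset.univ.filter fun i => η i = parent (w.letter i)).card

end Word

/-!
Fix `w`. Since `ζ * μ = 1` determines `μ` in the incidence algebra, it suffices to show that
`∑ (-1)^def(η) = δ_{u,w}`, where `η` runs over all normal words below `w` whose restriction to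
nonzero letters is at least `u` (`IsRootedForest.sum_Icc_normalEmbeddings`).

Whether `u` is at most that restriction is decided by reading `η` from left to right and matching
the letters of `u` greedily (`matches_cons_iff`), so the sum can be computed one letter of `w` at a
time. Let `T_y` be the operator that reads the letter `y` of `P_0`; it removes the first letter
of `u` if that letter is at most `y`. A letter `x` of `w` contributes `T_x - T_{x^-}` at the
start of a run and `T_x - T_{x^-} + 1` inside a run; the different rules for minimal and for
nonminimal `x` both come down to this, because `T_0 = 1` (`IsRootedForest.sum_allowed`). In a rooted
forest, the elements below `x` are `x` and those below `x^-`, hence `T_x` and `T_{x^-}` differ only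
on words `u` that begin with `x` itself. The order of `P` has thereby disappeared from the
computation, and what remains is a short induction on `w`
(`IsRootedForest.signedSum_sub_and_cons`): behind a letter `x`, the sums for `u` and for `xu` differ
by `1` if `u` is the part of `w` still to be read, and agree otherwise.
-/

/-! ### Parents in a rooted forest -/

section Forest

variable {P : Type*} [PartialOrder P] [LocallyFiniteOrder (WithBot P)]

theorem IsRootedForest.parent_covBy (hP : IsRootedForest P) (x : P) :
    parent x ⋖ (x : WithBot P) :=
  (hP.covBy_iff_eq_parent x _).2 rfl

theorem IsRootedForest.parent_eq_bot_iff (hP : IsRootedForest P) {x : P} :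
    parent x = ⊥ ↔ IsMin x := by
  rw [← WithBot.bot_covBy_coe, hP.covBy_iff_eq_parent, eq_comm]

/-- Here the uniqueness of `x^-` matters: passing from `x` to `x^-` loses the element `x` and
nothing else. -/
theorem IsRootedForest.coe_le_parent_iff (hP : IsRootedForest P) {a x : P} :
    (a : WithBot P) ≤ parent x ↔ a < x := by
  constructor
  · intro h
    exact WithBot.coe_lt_coe.1 (h.trans_lt (hP.parent_covBy x).lt)
  · intro h
    obtain ⟨q, hq, hqx⟩ := exists_le_covBy_of_lt (WithBot.coe_lt_coe.2 h)
    rwa [(hP.covBy_iff_eq_parent x q).1 hqx] at hq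

end Forest

/-! ### Words over `P_0` and greedy matching -/

namespace Word

section Reduction

variable {P : Type*}

/-- The restriction of a word over `P_0` to its nonzero letters. -/
def reduce (l : List (WithBot P)) : Word P :=
  ⟨l.filterMap fun y => y.recBotCoe Option.none Option.some⟩

open Classical in
theorem map_reduce (l : List (WithBot P)) :
    (reduce l).letters.map WithBot.some = l.filter (fun x => x ≠ ⊥) := by
  induction l with
  | nil => rfl
  | cons y l ih =>
    simp only [reduce] at ih
    induction y with
    | bot =>
      rw [List.filter_cons_of_neg (by simp)]
      exact ih
    | coe a =>
      rw [List.filter_cons_of_pos (by simp), ← ih]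
      rfl

theorem isExpansion_iff {u : Word P} {n : ℕ} {η : Fin n → WithBot P} :
    IsExpansion u η ↔ reduce (List.ofFn η) = u := by
  rw [IsExpansion, ← map_reduce, (List.map_injective_iff.2 WithBot.coe_injective).eq_iff,
    Word.ext_iff]

end Reduction

section Matching

variable {P : Type*} [PartialOrder P]

open Classical in
/-- One step of greedy matching: the part of the word `u` that is still to be matched after the
letter `y` of `P_0` has been read. -/
noncomputable def strip (y : WithBot P) : List P → List P
  | [] => []
  | a :: u => if (a : WithBot P) ≤ y then u else a :: u

/-- The word `u` over `P` matches into the word `l` over `P_0`. -/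
abbrev Matches (u : List P) (l : List (WithBot P)) : Prop :=
  List.SublistForall₂ (fun (a : P) (y : WithBot P) => (a : WithBot P) ≤ y) u l

@[simp] theorem strip_nil (y : WithBot P) : strip y [] = [] := rfl

@[simp] theorem strip_bot (u : List P) : strip ⊥ u = u := by
  cases u <;> simp [strip]

theorem matches_of_cons {a : P} {u : List P} {l : List (WithBot P)} (h : Matches (a :: u) l) :
    Matches u l := by
  induction l with
  | nil => cases h
  | cons y l ih =>
    cases h with
    | cons _ h => exact .cons_right h
    | cons_right h => exact .cons_right (ih h)

/-- Greedy matching is optimal. -/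
theorem matches_cons_iff (u : List P) (y : WithBot P) (l : List (WithBot P)) :
    Matches u (y :: l) ↔ Matches (strip y u) l := by
  cases u with
  | nil => exact ⟨fun _ => .nil, fun _ => .nil⟩
  | cons a u =>
    by_cases h : (a : WithBot P) ≤ y
    · rw [strip, if_pos h]
      refine ⟨fun H => ?_, fun H => .cons h H⟩
      cases H with
      | cons _ H => exact H
      | cons_right H => exact matches_of_cons H
    · rw [strip, if_neg h]
      refine ⟨fun H => ?_, fun H => .cons_right H⟩
      cases H with
      | cons h' _ => exact absurd h' h
      | cons_right H => exact H

theorem matches_nil_iff (u : List P) : Matches u ([] : List (WithBot P)) ↔ u = [] :=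
  ⟨fun h => by cases h; rfl, fun h => h ▸ .nil⟩

theorem le_iff_sublistForall₂ {u w : Word P} :
    u ≤ w ↔ List.SublistForall₂ (fun a b : P => a ≤ b) u.letters w.letters := by
  rw [List.sublistForall₂_iff]
  exact ⟨fun ⟨l, h, h'⟩ => ⟨l, h', h⟩, fun ⟨l, h, h'⟩ => ⟨l, h', h⟩⟩

theorem le_reduce_iff {u : Word P} {l : List (WithBot P)} :
    u ≤ reduce l ↔ Matches u.letters l := by
  have h : ∀ v : List P, Matches v ((reduce l).letters.map WithBot.some) ↔ Matches v l := by
    induction l with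
    | nil => intro v; rfl
    | cons y l ih =>
      intro v
      rw [map_reduce] at ih ⊢
      rw [matches_cons_iff v y]
      induction y with
      | bot => simpa using ih v
      | coe a => simpa [matches_cons_iff] using ih (strip (a : WithBot P) v)
  rw [← h, le_iff_sublistForall₂, Matches, List.sublistForall₂_map_right_iff]
  simp only [WithBot.coe_le_coe]

theorem reduce_ofFn_le {w : Word P} {η : Fin w.length → WithBot P}
    (h : ∀ j, η j ≤ (w.letter j : WithBot P)) : reduce (List.ofFn η) ≤ w := by
  have key : ∀ (l : List P) (η : Fin l.length → WithBot P),
      (∀ j, η j ≤ (l.get j : WithBot P)) →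
      List.SublistForall₂ (fun a b : P => a ≤ b) (reduce (List.ofFn η)).letters l := by
    intro l
    induction l with
    | nil => intro η _; exact .nil
    | cons x l ih =>
      intro η h
      have h₀ := h 0
      have ih := ih (fun j => η j.succ) fun j => h j.succ
      rw [show List.ofFn η = η 0 :: List.ofFn (fun j : Fin l.length => η j.succ) from
        List.ofFn_succ]
      generalize η 0 = y at h₀
      induction y with
      | bot => exact .cons_right ih
      | coe a => exact .cons (WithBot.coe_le_coe.1 h₀) ih
  exact le_iff_sublistForall₂.2 (key _ _ h)

end Matching

/-! ### Runs -/

section Runs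

variable {P : Type*}

/-- The letter in front of position `j` of `l`, where `p` is in front of the whole word. -/
def prev (p : Option P) (l : List P) (j : Fin l.length) : Option P :=
  (p :: l.map Option.some).get ⟨j, by simp⟩

theorem prev_none_eq_some_iff (l : List P) (j : Fin l.length) (x : P) :
    prev none l j = some x ↔ ∃ i : Fin l.length, (i : ℕ) + 1 = j ∧ l.get i = x := by
  obtain ⟨j, hj⟩ := j
  cases j with
  | zero => simp [prev]
  | succ j =>
    simp only [prev, List.get_eq_getElem, List.getElem_cons_succ, List.getElem_map,
      Option.some.injEq, Nat.add_right_cancel_iff]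
    constructor
    · intro h
      exact ⟨⟨j, by omega⟩, rfl, h⟩
    · rintro ⟨i, rfl, h⟩
      exact h

theorem exists_isRun (w : Word P) (j : Fin w.length) :
    ∃ r t, r ≤ j ∧ j ≤ t ∧ IsRun w (w.letter j) r t := by
  obtain ⟨r, ⟨hrj, hr⟩, hrmin⟩ := Set.exists_min_image
    {r : Fin w.length | r ≤ j ∧ ∀ i ∈ Set.Icc r j, w.letter i = w.letter j} id
    (Set.toFinite _) ⟨j, le_rfl, fun i hi => by rw [le_antisymm hi.2 hi.1]⟩
  obtain ⟨t, ⟨hjt, ht⟩, htmax⟩ := Set.exists_max_image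
    {t : Fin w.length | j ≤ t ∧ ∀ i ∈ Set.Icc j t, w.letter i = w.letter j} id
    (Set.toFinite _) ⟨j, le_rfl, fun i hi => by rw [le_antisymm hi.2 hi.1]⟩
  refine ⟨r, t, hrj, hjt, hrj.trans hjt, fun i hi => ?_, fun r' t' hr' ht' h => ?_⟩
  · rcases le_total i j with hij | hij
    · exact hr i ⟨hi.1, hij⟩
    · exact ht i ⟨hij, hi.2⟩
  · exact ⟨le_antisymm hr' (hrmin r' ⟨hr'.trans hrj, fun i hi => h i ⟨hi.1, hi.2.trans
      (hjt.trans ht')⟩⟩), le_antisymm (htmax t' ⟨hjt.trans ht', fun i hi => h i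
      ⟨(hr'.trans hrj).trans hi.1, hi.2⟩⟩) ht'⟩

/-- The letter in front of a run differs from the letter of the run. -/
theorem IsRun.prev_ne {w : Word P} {x : P} {r t : Fin w.length} (h : IsRun w x r t) :
    prev none w.letters r ≠ some x := by
  intro hp
  obtain ⟨i, hi, hx⟩ := (prev_none_eq_some_iff _ _ _).1 hp
  have hir : i < r := Fin.lt_def.2 (by omega)
  refine hir.ne (h.2.2 i t hir.le le_rfl fun k hk => ?_).1
  rcases hk.1.eq_or_lt with rfl | hik
  · exact hx
  · exact h.2.1 k ⟨Fin.le_def.2 (by have := Fin.lt_def.1 hik; omega), hk.2⟩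

theorem IsRun.prev_eq {w : Word P} {x : P} {r t j : Fin w.length} (h : IsRun w x r t)
    (hrj : r < j) (hjt : j ≤ t) : prev none w.letters j = some x := by
  have hlt := Fin.lt_def.1 hrj
  rw [prev_none_eq_some_iff]
  refine ⟨⟨j - 1, (Nat.sub_le _ _).trans_lt j.isLt⟩, by simp only; omega,
    h.2.1 _ ⟨Fin.le_def.2 ?_, Fin.le_def.2 ?_⟩⟩
  · simp only; omega
  · have := Fin.le_def.1 hjt
    simp only; omega

/-- The condition on runs can be checked position by position, by comparing each letter with the
one in front of it. -/
theorem forall_isRun_iff [PartialOrder P] (w : Word P) (η : Fin w.length → WithBot P) :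
    (∀ (x : P) (r t : Fin w.length), IsRun w x r t →
      (IsMin x → ∀ j, r < j → j ≤ t → η j ≠ ⊥) ∧ (¬ IsMin x → η r ≠ ⊥)) ↔
    ∀ j, (prev none w.letters j = some (w.letter j) ↔ IsMin (w.letter j)) → η j ≠ ⊥ := by
  constructor
  · intro h j hj
    obtain ⟨r, t, hrj, hjt, hrun⟩ := exists_isRun w j
    by_cases hmin : IsMin (w.letter j)
    · refine (h _ r t hrun).1 hmin j (hrj.lt_of_ne ?_) hjt
      rintro rfl
      exact hrun.prev_ne (hj.2 hmin)
    · rcases hrj.eq_or_lt with rfl | hlt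
      · exact (h _ r t hrun).2 hmin
      · exact absurd (hj.1 (hrun.prev_eq hlt hjt)) hmin
  · intro h x r t hrun
    refine ⟨fun hmin j hrj hjt => h j ?_, fun hmin => h r ?_⟩
    · rw [hrun.2.1 j ⟨hrj.le, hjt⟩]
      exact iff_of_true (hrun.prev_eq hrj hjt) hmin
    · rw [hrun.2.1 r ⟨le_rfl, hrun.1⟩]
      exact iff_of_false hrun.prev_ne hmin

end Runs

/-! ### The signed sum over normal words -/

section SignedSum

variable {P : Type*} [PartialOrder P]

open Classical in
/-- The letters of `P_0` that a normal embedding may put at a position where `w` has the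
letter `x`, preceded by the letter `p` (`none` at the front of the word). -/
noncomputable def allowed (p : Option P) (x : P) : Finset (WithBot P) :=
  ({(x : WithBot P), parent x, ⊥} : Finset (WithBot P)).filter fun y =>
    (p = some x ↔ IsMin x) → y ≠ ⊥

open Classical in
/-- The sign that the letter `y` of an embedding contributes at a position with letter `x`. -/
noncomputable def letterSign (x : P) (y : WithBot P) : ℤ := if y = parent x then -1 else 1

open Classical in
/-- The sum of `(-1)^def(η)` over the normal `η` in `l` into which `u` matches; here the word `l`
is regarded as preceded by the letter `p`. -/
noncomputable def signedSum (p : Option P) (l u : List P) : ℤ :=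
  ∑ η ∈ Fintype.piFinset fun j => allowed (prev p l j) (l.get j),
    if Matches u (List.ofFn η) then ∏ j, letterSign (l.get j) (η j) else 0

theorem signedSum_nil (p : Option P) (u : List P) :
    signedSum p [] u = if u = [] then 1 else 0 := by
  classical
  rw [signedSum]
  have : (Fintype.piFinset fun j : Fin ([] : List P).length =>
      allowed (prev p [] j) (([] : List P).get j)) = {fun j => j.elim0} := by
    ext η
    simp only [Fintype.mem_piFinset, Finset.mem_singleton]
    exact ⟨fun _ => funext fun j => j.elim0, fun _ j => j.elim0⟩
  rw [this, Finset.sum_singleton]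
  change (if Matches u [] then _ else _) = _
  simp [matches_nil_iff]

theorem signedSum_cons_eq_sum (p : Option P) (x : P) (l u : List P) :
    signedSum p (x :: l) u =
      ∑ y ∈ allowed p x, letterSign x y * signedSum (some x) l (strip y u) := by
  classical
  simp only [signedSum, Finset.mul_sum]
  rw [← Finset.sum_product']
  symm
  refine Finset.sum_bij'
    (i := fun z _ => (Fin.cons z.1 z.2 : Fin (l.length + 1) → WithBot P))
    (j := fun (η : Fin (l.length + 1) → WithBot P) _ => (η 0, fun j : Fin l.length => η j.succ))
    ?_ ?_ ?_ ?_ ?_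
  · rintro ⟨y, η⟩ h
    rw [Finset.mem_product, Fintype.mem_piFinset] at h
    rw [Fintype.mem_piFinset]
    intro j
    induction j using Fin.cases with
    | zero => exact h.1
    | succ j => exact h.2 j
  · intro η h
    rw [Fintype.mem_piFinset] at h
    rw [Finset.mem_product, Fintype.mem_piFinset]
    exact ⟨h 0, fun j => h j.succ⟩
  · rintro ⟨y, η⟩ _
    rfl
  · intro η _
    exact Fin.cons_self_tail η
  · rintro ⟨y, η⟩ _
    simp only [List.length_cons, List.ofFn_succ, Fin.cons_zero, Fin.cons_succ, matches_cons_iff,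
      Fin.prod_univ_succ, mul_ite, mul_zero]
    rfl

variable [LocallyFiniteOrder (WithBot P)]

open Classical in
/-- The contribution of one letter of `w`. The formula is the same for minimal and nonminimal `x`:
for minimal `x` the term for `x^-` is the term for `0`, and inside a run it cancels the last
summand. -/
theorem _root_.IsRootedForest.sum_allowed (hP : IsRootedForest P) (p : Option P) (x : P)
    (g : WithBot P → ℤ) :
    ∑ y ∈ allowed p x, letterSign x y * g y =
      g x - g (parent x) + if p = some x then g ⊥ else 0 := by
  have hx : (x : WithBot P) ≠ parent x := (hP.parent_covBy x).lt.ne'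
  by_cases hmin : IsMin x
  · have hpar := hP.parent_eq_bot_iff.2 hmin
    by_cases hp : p = some x
    · -- Here only `x` remains, and the terms for `x^- = 0` cancel.
      have : allowed p x = {(x : WithBot P)} := by
        ext y
        simp only [allowed, hp, hmin, hpar, Finset.mem_filter, Finset.mem_insert,
          Finset.mem_singleton]
        aesop
      rw [this, Finset.sum_singleton]
      simp [letterSign, hp, hpar]
    · have : allowed p x = {(x : WithBot P), ⊥} := by
        ext y
        simp only [allowed, hp, hmin, hpar, Finset.mem_filter, Finset.mem_insert,
          Finset.mem_singleton]
        aesop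
      rw [this, Finset.sum_pair (by simp)]
      simp [letterSign, hp, hpar, sub_eq_add_neg]
  · have hpar : parent x ≠ ⊥ := fun h => hmin (hP.parent_eq_bot_iff.1 h)
    by_cases hp : p = some x
    · have : allowed p x = {(x : WithBot P), parent x, ⊥} := by
        simp [allowed, hp, hmin]
      rw [this, Finset.sum_insert (by simp [hx]), Finset.sum_pair hpar]
      simp only [letterSign, hx, hpar.symm, hp, if_true, if_false]
      ring
    · have : allowed p x = {(x : WithBot P), parent x} := by
        ext y
        simp only [allowed, hp, hmin, Finset.mem_filter, Finset.mem_insert,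
          Finset.mem_singleton]
        aesop
      rw [this, Finset.sum_pair hx]
      simp only [letterSign, hx, hp, if_true, if_false]
      ring

open Classical in
theorem _root_.IsRootedForest.signedSum_cons (hP : IsRootedForest P) (p : Option P) (x : P)
    (l u : List P) :
    signedSum p (x :: l) u = signedSum (some x) l (strip x u) -
      signedSum (some x) l (strip (parent x) u) +
        if p = some x then signedSum (some x) l u else 0 := by
  rw [signedSum_cons_eq_sum, hP.sum_allowed p x fun y => signedSum (some x) l (strip y u),
    strip_bot]

theorem _root_.IsRootedForest.strip_parent (hP : IsRootedForest P) {x : P} {u : List P}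
    (h : u.head? ≠ some x) : strip (parent x) u = strip (x : WithBot P) u := by
  cases u with
  | nil => rfl
  | cons a u =>
    have hax : a ≠ x := by simpa using h
    unfold strip
    classical
    refine if_congr ?_ rfl rfl
    rw [hP.coe_le_parent_iff, WithBot.coe_le_coe, lt_iff_le_and_ne, and_iff_left hax]

theorem _root_.IsRootedForest.strip_parent_cons_self (hP : IsRootedForest P) (x : P) (u : List P) :
    strip (parent x) (x :: u) = x :: u := by
  simp [strip, hP.coe_le_parent_iff]

open Classical in
/-- The cancellation: behind a letter `x`, matching `u` and matching `xu` have the same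
signed sum, except that `l` itself is counted once. The second conjunct solves the recursion for
`signedSum` and is proved along with the first. -/
theorem _root_.IsRootedForest.signedSum_sub_and_cons (hP : IsRootedForest P) (l : List P) :
    (∀ (x : P) (u : List P),
      signedSum (some x) l u - signedSum (some x) l (x :: u) = if l = u then 1 else 0) ∧
    ∀ (p : Option P) (x : P) (u : List P), signedSum p (x :: l) u =
      (if x :: l = u then 1 else 0) + if p = some x then signedSum (some x) l u else 0 := by
  induction l with
  | nil =>
    refine ⟨fun x u => by simp [signedSum_nil, eq_comm], fun p x u => ?_⟩
    rw [hP.signedSum_cons]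
    congr 1
    by_cases h : u.head? = some x
    · obtain ⟨u, rfl⟩ : ∃ v, u = x :: v := ⟨_, List.eq_cons_of_mem_head? h⟩
      rw [hP.strip_parent_cons_self]
      simp [strip, signedSum_nil, eq_comm]
    · rw [hP.strip_parent h, sub_self, if_neg]
      rintro rfl
      exact h rfl
  | cons z l ih =>
    have key : ∀ (x : P) (u : List P), signedSum (some x) (z :: l) u -
        signedSum (some x) (z :: l) (x :: u) = if z :: l = u then 1 else 0 := by
      intro x u
      rw [ih.2, ih.2]
      by_cases hxz : x = z
      · subst hxz
        have := ih.1 x u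
        simp only [if_true, List.cons.injEq, true_and] at this ⊢
        linarith
      · simp [hxz, Ne.symm hxz]
    refine ⟨key, fun p x u => ?_⟩
    rw [hP.signedSum_cons]
    congr 1
    by_cases h : u.head? = some x
    · obtain ⟨u, rfl⟩ : ∃ v, u = x :: v := ⟨_, List.eq_cons_of_mem_head? h⟩
      rw [hP.strip_parent_cons_self]
      simpa [strip] using key x u
    · rw [hP.strip_parent h, sub_self, if_neg]
      rintro rfl
      exact h rfl

open Classical in
theorem _root_.IsRootedForest.signedSum_none (hP : IsRootedForest P) (l u : List P) :
    signedSum none l u = if u = l then 1 else 0 := by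
  cases l with
  | nil => exact signedSum_nil none u
  | cons x l => simp [(hP.signedSum_sub_and_cons l).2, eq_comm]

end SignedSum

/-! ### The Möbius function -/

section Moebius

variable {P : Type*} [PartialOrder P]

theorem IsNormalEmbedding.le {u w : Word P} {η : Fin w.length → WithBot P}
    (h : IsNormalEmbedding u w η) : u ≤ w :=
  isExpansion_iff.1 h.1.1 ▸ reduce_ofFn_le h.1.2

theorem prod_letterSign (w : Word P) (η : Fin w.length → WithBot P) :
    ∏ j, letterSign (w.letter j) (η j) = (-1) ^ defect w η := by
  classical
  simp only [letterSign, defect, Finset.prod_ite, Finset.prod_const, one_pow, mul_one]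

theorem mem_piFinset_allowed_iff (w : Word P) (η : Fin w.length → WithBot P) :
    (η ∈ Fintype.piFinset fun j => allowed (prev none w.letters j) (w.letter j)) ↔
    (∀ j, η j = (w.letter j : WithBot P) ∨ η j = parent (w.letter j) ∨ η j = ⊥) ∧
    ∀ (x : P) (r t : Fin w.length), IsRun w x r t →
      (IsMin x → ∀ j, r < j → j ≤ t → η j ≠ ⊥) ∧ (¬ IsMin x → η r ≠ ⊥) := by
  classical
  simp only [forall_isRun_iff, Fintype.mem_piFinset, allowed, Finset.mem_filter,
    Finset.mem_insert, Finset.mem_singleton]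
  exact forall_and

variable [LocallyFiniteOrder (WithBot P)]

theorem _root_.IsRootedForest.le_letter (hP : IsRootedForest P) {w : Word P}
    {η : Fin w.length → WithBot P}
    (h : ∀ j, η j = (w.letter j : WithBot P) ∨ η j = parent (w.letter j) ∨ η j = ⊥)
    (j : Fin w.length) : η j ≤ (w.letter j : WithBot P) := by
  rcases h j with h | h | h
  · exact h.le
  · exact h.le.trans (hP.parent_covBy _).le
  · exact h.le.trans bot_le

open Classical in
theorem _root_.IsRootedForest.normalEmbeddings_eq_filter (hP : IsRootedForest P) (u w : Word P) :
    normalEmbeddings u w =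
      (Fintype.piFinset fun j => allowed (prev none w.letters j) (w.letter j)).filter
        fun η => reduce (List.ofFn η) = u := by
  ext η
  rw [mem_normalEmbeddings, Finset.mem_filter, mem_piFinset_allowed_iff, IsNormalEmbedding,
    IsEmbedding, isExpansion_iff]
  exact ⟨fun h => ⟨h.2, h.1.1⟩, fun h => ⟨⟨h.2, hP.le_letter h.1.1⟩, h.1⟩⟩

open Classical in
/-- The signed count of normal embeddings satisfies the defining recursion of the Möbius
function. -/
theorem _root_.IsRootedForest.sum_Icc_normalEmbeddings (hP : IsRootedForest P) (u w : Word P) :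
    ∑ v ∈ Finset.Icc u w, ∑ η ∈ normalEmbeddings v w, (-1 : ℤ) ^ defect w η =
      if u = w then 1 else 0 := by
  simp only [hP.normalEmbeddings_eq_filter, Finset.sum_filter]
  rw [Finset.sum_comm]
  simp only [Finset.sum_ite_eq, Finset.mem_Icc]
  rw [if_congr Word.ext_iff rfl rfl, ← hP.signedSum_none, signedSum]
  refine Finset.sum_congr rfl fun η hη => ?_
  have hle := reduce_ofFn_le (hP.le_letter ((mem_piFinset_allowed_iff w η).1 hη).1)
  simp only [hle, and_true, le_reduce_iff, prod_letterSign]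

theorem _root_.IsRootedForest.moebius_eq (hP : IsRootedForest P) (u w : Word P) :
    moebius u w = ∑ η ∈ normalEmbeddings u w, (-1 : ℤ) ^ defect w η := by
  classical
  let f : IncidenceAlgebra ℤ (Word P) :=
    ⟨fun u w => ∑ η ∈ normalEmbeddings u w, (-1 : ℤ) ^ defect w η, fun u w h =>
      Finset.sum_eq_zero fun η hη => absurd ((mem_normalEmbeddings u w η).1 hη).le h⟩
  have hf : IncidenceAlgebra.zeta ℤ * f = 1 := by
    ext u w _
    rw [IncidenceAlgebra.mul_apply, IncidenceAlgebra.one_apply, ← hP.sum_Icc_normalEmbeddings]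
    refine Finset.sum_congr rfl fun v hv => ?_
    rw [IncidenceAlgebra.zeta_of_le (Finset.mem_Icc.1 hv).1, one_mul]
    rfl
  have h : IncidenceAlgebra.mu ℤ = f := 
    left_inv_eq_right_inv (IncidenceAlgebra.mu_mul_zeta ℤ (Word P)) hf
  calc moebius u w = IncidenceAlgebra.mu ℤ u w := by unfold moebius; congr!
    _ = f u w := by rw [h]

end Moebius

end Word

/-! ### The chain of positive integers -/

section PNat

theorem PNat.isAcyclic_hasse : (SimpleGraph.hasse ℕ+).IsAcyclic := by
  -- Deleting the edge `{a, b}` with `a ⋖ b` separates the elements `≤ a` from the others.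
  have key : ∀ a b : ℕ+, a ⋖ b → (SimpleGraph.hasse ℕ+).IsBridge s(a, b) := by
    intro a b hab
    rw [SimpleGraph.isBridge_iff]
    intro hr
    have inv : ∀ c d : ℕ+, ((SimpleGraph.hasse ℕ+).deleteEdges {s(a, b)}).Reachable c d →
        c ≤ a → d ≤ a := by
      rintro c d ⟨p⟩
      induction p with
      | nil => exact id
      | @cons c e d hadj p ih =>
        refine fun hc => ih ?_
        rw [SimpleGraph.deleteEdges_adj] at hadj
        obtain ⟨h | h, hne⟩ := hadj
        · by_contra he
          have hca : c = a := le_antisymm hc (not_lt.1 fun h' => h.2 h' (not_le.1 he))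
          subst hca
          exact hne (by rw [h.unique_right hab]; rfl)
        · exact h.le.trans hc
    exact absurd (inv a b hr le_rfl) (not_le.2 hab.lt)
  rw [SimpleGraph.isAcyclic_iff_forall_adj_isBridge]
  rintro a b (h | h)
  · exact key a b h
  · rw [Sym2.eq_swap]
    exact key b a h

theorem PNat.isRootedForest : IsRootedForest ℕ+ := by
  intro C
  have hC : ∀ x : ℕ+, x ∈ C := by
    intro x
    induction C using SimpleGraph.ConnectedComponent.ind with
    | h v => exact SimpleGraph.ConnectedComponent.sound (
        SimpleGraph.hasse_preconnected_of_succ ℕ+ x v)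
  refine ⟨⟨C.connected_toSimpleGraph, PNat.isAcyclic_hasse.induce _⟩, 1,
    ⟨hC 1, fun y _ _ => one_le⟩, fun m hm => ?_⟩
  exact le_antisymm (hm.2 (hC 1) one_le) one_le

theorem PNat.parent_eq (k : ℕ+) :
    parent k = if k = 1 then ⊥ else ((k - 1 : ℕ+) : WithBot ℕ+) := by
  symm
  rw [← PNat.isRootedForest.covBy_iff_eq_parent]
  split_ifs with h
  · subst h
    exact WithBot.bot_covBy_coe.2 fun y _ => one_le
  · rw [WithBot.coe_covBy_coe]
    have h1 : (1 : ℕ+) < k := lt_of_le_of_ne one_le (Ne.symm h)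
    have : k - 1 + 1 = k := PNat.sub_add_of_lt h1
    conv_rhs => rw [← this]
    exact Order.covBy_add_one _

end PNat

theorem mainTheorem4 :
    (∀ (P : Type*) [PartialOrder P] [LocallyFiniteOrder (WithBot P)], IsRootedForest P →
      ∀ u w : Word P,
        Word.moebius u w = ∑ η ∈ Word.normalEmbeddings u w, (-1 : ℤ) ^ Word.defect w η) ∧
    (IsRootedForest ℕ+ ∧
      (∀ k : ℕ+, parent k = if k = 1 then ⊥ else ((k - 1 : ℕ+) : WithBot ℕ+)) ∧
      ∀ u w : Word ℕ+,
        Word.moebius u w = ∑ η ∈ Word.normalEmbeddings u w, (-1 : ℤ) ^ Word.defect w η) :=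
  ⟨fun _ _ _ hP => hP.moebius_eq,
    PNat.isRootedForest, PNat.parent_eq, PNat.isRootedForest.moebius_eq⟩
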